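/- **Theorem (local regime).** Let $\beta>1$ and let $\ell:[0,\infty)\to(0,\infty)$ be a slowly varying function, that is, $\ell$ is measurable and $\ell(ax)/\ell(x)\to 1$ as $x\to+\infty$ for every $a>0$. Let $\mu$ be a probability distribution on $\mathbb{Z}_{\geq 0}$ such that $\mu(0)>0$ and $\mu(i)=\ell(i)/i^{1+\beta}$ for all $i\geq 1$. For fixed $k\geq 1$ and $n>k$, let $T_{n,k}$ be a $\mu$-Bienaymé–Galton–Watson tree (a rooted planar tree) conditioned to have $n$ vertices and $k$ internal nodes (vertices with at least one child). Let $D_{n,k}$ be the random tree defined as follows. Let $Z_1,\ldots,Z_{k-1}$ be i.i.d. random variables with $\mathbb{P}(Z_1=j)=\mu(j)/(1-\mu(0))$ for all $j\geq 1$. - On the event $G_{n,k}=\{Z_1+\cdots+Z_{k-1}\leq n-k\}$, the tree obtained from $D_{n,k}$ by removing all its leaves is $\ast_k$, the tree consisting of a root with $k-1$ children that are all leaves; for $1\leq i\leq k-1$, the $i$-th non-root internal node of $D_{n,k}$ has exactly $Z_i$ children, all of which are leaves; and, conditionally given $(Z_1,\ldots,Z_{k-1})$, the numbers $(c_1,\ldots,c_k)$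 of leaves grafted in the $k$ successive corners of the root (before, between and after its $k-1$ internal children) form a uniformly random composition of $n-k-(Z_1+\cdots+Z_{k-1})$ into $k$ nonnegative integer parts. - On the complement of $G_{n,k}$, $D_{n,k}$ is set to be an arbitrary fixed tree $a_n$ (for instance, one with $n$ vertices and $k$ internal nodes). Then, for every fixed $k\geq 1$ and every choice of the trees $(a_n)$, $$d_{TV}\bigl(T_{n,k},D_{n,k}\bigr)\xrightarrow[n\to+\infty]{}0,$$ where $d_{TV}(X,Y)=\sup_A|\mathbb{P}(X\in A)-\mathbb{P}(Y\in A)|$ is the total variation distance between the laws. -/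

import Mathlib

open Filter Topology MeasureTheory ProbabilityTheory
open scoped NNReal ENNReal

/-- A (finite) rooted planar tree: a root together with the ordered list of the subtrees
hanging from its children. -/
inductive PlaneTree : Type
  | node (children : List PlaneTree) : PlaneTree

namespace PlaneTree

/-- The tree with a single vertex. -/
def leaf : PlaneTree := node []

/-- The list of subtrees hanging from the children of the root. -/
def children : PlaneTree → List PlaneTree
  | node l => l

/-- Whether the root is an internal node, i.e. has at least one child. -/
def isInternal (t : PlaneTree) : Bool := !t.children.isEmpty

/-- Number of vertices. -/
def numVertices : PlaneTree → ℕ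
  | node l => 1 + (l.map numVertices).sum

/-- Number of internal nodes, i.e. of vertices with at least one child. -/
def numInternal : PlaneTree → ℕ
  | node l => (if l.isEmpty then 0 else 1) + (l.map numInternal).sum

/-- The reduced tree, obtained by removing all leaves (for a tree whose root is internal). -/
def reduced : PlaneTree → PlaneTree
  | node l => node ((l.filter isInternal).map reduced)

/-- The sequence of leaves. The internal nodes are visited in lexicographic order, and around
each of them the corners delimited by its parent edge and the edges to its internal children are
visited from left to right; the entry at a corner is the number of leaves grafted there, or this
number minus one when the node is a leaf of the reduced tree. -/
def leafSeq : PlaneTree → List ℕ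
  | node l =>
    if (l.filter isInternal).isEmpty then [l.length - 1]
    else (l.splitOnP isInternal).map List.length ++ ((l.filter isInternal).map leafSeq).flatten

/-- A root with `j` children, all of them leaves. -/
def corolla (j : ℕ) : PlaneTree := node (List.replicate j leaf)

/-- The tree `∗_k`: a root to which `k - 1` leaves are attached. -/
def star (k : ℕ) : PlaneTree := corolla (k - 1)

/-- The set `𝕋_{n,k}` of trees with `n` vertices and `k` internal nodes. -/
def treesWith (n k : ℕ) : Set PlaneTree := {t | t.numVertices = n ∧ t.numInternal = k}

/-- The tree whose root has `m` internal children, the `i`-th of which carries `z i` leaves, and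
with `c 0, …, c m` leaves grafted in the `m + 1` successive corners of the root. -/
def condensate {m : ℕ} (c : Fin (m + 1) → ℕ) (z : Fin m → ℕ) : PlaneTree :=
  node (List.replicate (c 0) leaf ++
    (List.ofFn fun i : Fin m => corolla (z i) :: List.replicate (c i.succ) leaf).flatten)

/-- `Codes C t`: the family of offspring numbers `C`, indexed by words (the empty word is the
root and the children of `u` are `u0, u1, …`), generates exactly the finite tree `t`, i.e.
`c_u(t) = C u` for all vertices `u` of `t`. -/
inductive Codes : (List ℕ → ℕ) → PlaneTree → Prop
  | node (C : List ℕ → ℕ) (l : List PlaneTree) (h_root : C [] = l.length)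
      (h_sub : ∀ (i : ℕ) (hi : i < l.length), Codes (fun u => C (i :: u)) l[i]) :
      Codes C (node l)

/-- A family of offspring numbers generates at most one finite tree. -/
theorem Codes.unique {C : List ℕ → ℕ} {t : PlaneTree} (h : Codes C t) :
    ∀ {t' : PlaneTree}, Codes C t' → t = t' := by
  induction h with
  | node C l h_root h_sub ih =>
    intro t' h'
    cases h' with
    | node _ l' h_root' h_sub' =>
      have hl : l.length = l'.length := h_root.symm.trans h_root'
      congr 1
      exact List.ext_getElem hl fun i hi hi' => ih i hi (h_sub' i hi')

/-- All sets of finite trees are measurable. -/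
instance : MeasurableSpace PlaneTree := ⊤

instance : DiscreteMeasurableSpace PlaneTree := ⟨fun _ => trivial⟩

theorem isInternal_leaf : isInternal leaf = false := rfl

theorem isInternal_corolla {j : ℕ} (hj : 1 ≤ j) : isInternal (corolla j) = true := by
  obtain ⟨i, rfl⟩ := Nat.exists_eq_add_of_le' hj
  rfl

theorem filter_replicate_leaf (j : ℕ) : (List.replicate j leaf).filter isInternal = [] := by
  simp [isInternal_leaf]

theorem splitOnP_replicate_leaf (j : ℕ) :
    (List.replicate j leaf).splitOnP isInternal = [List.replicate j leaf] := by
  apply List.splitOnP_eq_singleton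
  simp [isInternal_leaf]

theorem reduced_corolla (j : ℕ) : (corolla j).reduced = leaf := by
  rw [corolla, reduced, filter_replicate_leaf]; rfl

theorem leafSeq_corolla (j : ℕ) : (corolla j).leafSeq = [j - 1] := by
  rw [corolla, leafSeq, filter_replicate_leaf]; simp

theorem condensate_filter {m : ℕ} (c : Fin (m + 1) → ℕ) (z : Fin m → ℕ) (hz : ∀ i, 1 ≤ z i) :
    (condensate c z).children.filter isInternal = List.ofFn fun i => corolla (z i) := by
  induction m with
  | zero => simp [condensate, children, isInternal_leaf]
  | succ m ih =>
    have h := ih (fun i => c i.succ) (fun i => z i.succ) fun i => hz i.succ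
    simp only [condensate, children] at h ⊢
    rw [List.ofFn_succ, List.ofFn_succ, List.flatten_cons, List.filter_append,
      filter_replicate_leaf, List.nil_append, List.cons_append,
      List.filter_cons_of_pos (isInternal_corolla (hz 0)), ← h]

theorem condensate_splitOnP {m : ℕ} (c : Fin (m + 1) → ℕ) (z : Fin m → ℕ) (hz : ∀ i, 1 ≤ z i) :
    ((condensate c z).children.splitOnP isInternal).map List.length = List.ofFn c := by
  induction m with
  | zero => simp [condensate, children, splitOnP_replicate_leaf]
  | succ m ih =>
    have h := ih (fun i => c i.succ) (fun i => z i.succ) fun i => hz i.succ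
    simp only [condensate, children] at h ⊢
    rw [List.ofFn_succ, List.ofFn_succ, List.flatten_cons, List.cons_append,
      List.splitOnP_append_cons _ _ (isInternal_corolla (hz 0)), splitOnP_replicate_leaf, ← h]
    simp

/-- The reduced tree of `condensate c z` is `∗_{m + 1}`. -/
theorem reduced_condensate {m : ℕ} (c : Fin (m + 1) → ℕ) (z : Fin m → ℕ) (hz : ∀ i, 1 ≤ z i) :
    (condensate c z).reduced = star (m + 1) := by
  have h := condensate_filter c z hz
  rw [condensate, children] at h
  rw [condensate, reduced, h, star, corolla]
  congr 1
  rw [List.map_ofFn]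
  simp [Function.comp_def, reduced_corolla]

/-- The sequence of leaves of `condensate c z`. -/
theorem leafSeq_condensate {m : ℕ} (hm : 1 ≤ m) (c : Fin (m + 1) → ℕ) (z : Fin m → ℕ)
    (hz : ∀ i, 1 ≤ z i) :
    (condensate c z).leafSeq = List.ofFn c ++ List.ofFn fun i => z i - 1 := by
  have h := condensate_filter c z hz
  have h' := condensate_splitOnP c z hz
  rw [condensate, children] at h h'
  rw [condensate, leafSeq, h, h', if_neg, List.map_ofFn]
  · congr 1
    have h1 : (leafSeq ∘ fun i => corolla (z i)) = fun i => [z i - 1] :=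
      funext fun i => leafSeq_corolla _
    rw [h1, List.ofFn_eq_map, List.ofFn_eq_map, ← List.flatMap_def, List.map_eq_flatMap]
  · simp; omega

end PlaneTree

/-- Total variation distance `sup_A |P(A) - Q(A)|` between two (probability) measures. -/
noncomputable def tvDist {α : Type*} [MeasurableSpace α] (P Q : Measure α) : ℝ :=
  ⨆ A : {A : Set α // MeasurableSet A}, |P.real A - Q.real A|

/-- Slowly varying functions `ℓ : ℝ₊ → ℝ₊*` (measurable, as usual). -/
structure SlowlyVarying (l : ℝ≥0 → ℝ) : Prop where
  measurable : Measurable l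
  pos : ∀ x, 0 < l x
  tendsto : ∀ a : ℝ≥0, 0 < a → Tendsto (fun x => l (a * x) / l x) atTop (𝓝 1)

/-- The law of the Bienaymé–Galton–Watson tree `T` with offspring distribution `μ`, restricted to
the event that `T` is finite: each finite tree `t` has mass `ℙ(T = t)`, the probability that an
i.i.d. family of `μ`-distributed offspring numbers, indexed by words, generates `t`. -/
noncomputable def bgwLaw (μ : PMF ℕ) : Measure PlaneTree :=
  Measure.sum fun t : PlaneTree =>
    Measure.infinitePi (fun _ : List ℕ => μ.toMeasure) {C | PlaneTree.Codes C t} •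
      Measure.dirac t

/-- The law of `T_{n,k}`, the `μ`-BGW tree conditioned on having `n` vertices and `k` internal
nodes. -/
noncomputable def condBGWLaw (μ : PMF ℕ) (n k : ℕ) : Measure PlaneTree :=
  (bgwLaw μ)[|PlaneTree.treesWith n k]

/-- The law `μ(j) / (1 - μ(0))`, `j ≥ 1`: `μ` conditioned to be positive. -/
noncomputable def posLaw (μ : PMF ℕ) : Measure ℕ := μ.toMeasure[|{j | 1 ≤ j}]

theorem posLaw_singleton (μ : PMF ℕ) {j : ℕ} (hj : 1 ≤ j) :
    posLaw μ {j} = μ j / (1 - μ 0) := by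
  have h1 : {j : ℕ | 1 ≤ j} = {0}ᶜ := by ext i; simp [Nat.one_le_iff_ne_zero]
  have h2 : {0}ᶜ ∩ {j} = ({j} : Set ℕ) := by ext i; simp; omega
  have h3 : μ.toMeasure {0}ᶜ = 1 - μ 0 := by
    rw [prob_compl_eq_one_sub (measurableSet_singleton 0),
      μ.toMeasure_apply_singleton 0 (measurableSet_singleton 0)]
  rw [posLaw, h1, cond_apply (measurableSet_singleton 0).compl, h2, h3,
    μ.toMeasure_apply_singleton j (measurableSet_singleton j), ENNReal.div_eq_inv_mul]

/-- The law of `D_{n,k}`, for `k ≥ 1`. The numbers of leaves `Z_1, …, Z_{k-1}` carried by the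
non-root internal nodes are i.i.d. with law `posLaw μ`; if `Z_1 + ⋯ + Z_{k-1} ≤ n - k`, the `k`
corners of the root receive a uniform composition (into `k` nonnegative parts) of the remaining
`n - k - (Z_1 + ⋯ + Z_{k-1})` leaves; otherwise the tree is set to be `a`. -/
noncomputable def condensateLaw (μ : PMF ℕ) (n k : ℕ) (a : PlaneTree) : Measure PlaneTree :=
  (Measure.pi fun _ : Fin (k - 1) => posLaw μ).bind fun z =>
    if (∑ i, z i) + k ≤ n then
      (uniformOn {c : Fin (k - 1 + 1) → ℕ | ∑ i, c i = n - k - ∑ i, z i}).map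
        fun c => PlaneTree.condensate c z
    else Measure.dirac a

/-!
A tree with `n` vertices and `k` internal nodes has probability `μ 0 ^ (n - k)` times the product of
`μ` over the offspring numbers of its internal nodes. On condensates with offspring numbers `z` at
the non-root internal nodes, the ratio of the probabilities under the conditioned tree and under
`condensateLaw` is therefore explicit (`massRatio`) and depends only on `z` and on the partition
function `bgwLaw μ (treesWith n k)`. If this ratio is asymptotically at least `1` for every fixed
`z`, then dominated convergence in `z` (Scheffé's argument, `condensateLaw_le`) gives convergence in
total variation; in particular only an *upper* bound on the partition function is needed, and the
other shapes of trees need no separate estimate.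

The partition function is bounded by Kemperman's formula: the forests of `m` trees with `m + s`
vertices and `k` internal nodes have total weight
`m / (m + s) * (m + s).choose k * μ 0 ^ (m + s - k) * [x ^ s] g ^ k`, where
`g = ∑_{j ≥ 1} μ j x ^ j`. This follows by removing the root of the first tree
(`PlaneTree.forestWeight_succ_le_tsum`), because the closed form obeys the same recursion
(`kemperman_succ_succ`).

It remains to know that `[x ^ n] g ^ k ∼ k (1 - μ 0) ^ (k - 1) μ n`, the one-big-jump principle
(`LongTailed.tendsto_coeff_pow`): in a convolution all indices but one stay bounded. The domination
needed for this, and `μ (n - s) ∼ μ n` for fixed `s`, come from the uniform convergence theorem for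
slowly varying functions (`eventually_forall_increment_lt`), which is where measurability of `ℓ`
enters.
-/

/-! ### Uniform convergence for slowly varying functions -/

/-- If `f (u + v) - f u → 0` for every `v`, then the exceptional sets of `v` along a sequence
`u n → ∞` have small measure. -/
theorem tendsto_volume_increment_ge {f : ℝ → ℝ} (hf : Measurable f)
    (h : ∀ v, Tendsto (fun u => f (u + v) - f u) atTop (𝓝 0)) {ε : ℝ} (hε : 0 < ε)
    {u : ℕ → ℝ} (hu : Tendsto u atTop atTop) :
    Tendsto (fun n => volume ({v | ε ≤ ‖f (u n + v) - f (u n)‖} ∩ Set.Icc (0 : ℝ) 3)) atTop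
      (𝓝 0) := by
  have key : TendstoInMeasure (volume.restrict (Set.Icc (0 : ℝ) 3))
      (fun n v => f (u n + v) - f (u n)) atTop (fun _ => 0) := by
    refine tendstoInMeasure_of_tendsto_ae (fun n => ?_) (ae_of_all _ fun v => (h v).comp hu)
    exact ((hf.comp (measurable_const_add _)).sub measurable_const).aestronglyMeasurable
  rw [tendstoInMeasure_iff_norm] at key
  refine (key ε hε).congr fun n => ?_
  rw [Measure.restrict_apply' measurableSet_Icc]
  simp

/-- The uniform convergence theorem for slowly varying functions, in additive notation: a `v`
outside the exceptional sets of both `u` and `u + t` compares `f u` and `f (u + t)` with the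
common value `f (u + v)`. -/
theorem eventually_forall_increment_lt {f : ℝ → ℝ} (hf : Measurable f)
    (h : ∀ v, Tendsto (fun u => f (u + v) - f u) atTop (𝓝 0)) {ε : ℝ} (hε : 0 < ε) :
    ∀ᶠ u in atTop, ∀ t ∈ Set.Icc (0 : ℝ) 1, |f (u + t) - f u| < ε := by
  by_contra hcon
  obtain ⟨u, hu, hbad⟩ := exists_seq_forall_of_frequently (not_eventually.1 hcon)
  push Not at hbad
  choose t ht hft using hbad
  have hut : Tendsto (fun n => u n + t n) atTop atTop :=
    tendsto_atTop_mono (fun n => le_add_of_nonneg_right (ht n).1) hu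
  have h1 := tendsto_volume_increment_ge hf h (half_pos hε) hu
  have h2 := tendsto_volume_increment_ge hf h (half_pos hε) hut
  have hhalf : (0 : ℝ≥0∞) < 2⁻¹ := by simp
  obtain ⟨n, hn1, hn2⟩ := ((h1.eventually_lt_const hhalf).and (h2.eventually_lt_const hhalf)).exists
  set A := {v | ε / 2 ≤ ‖f (u n + v) - f (u n)‖} ∩ Set.Icc (0 : ℝ) 3
  set B := {v | ε / 2 ≤ ‖f (u n + t n + v) - f (u n + t n)‖} ∩ Set.Icc (0 : ℝ) 3
  have hsub : Set.Icc (1 : ℝ) 3 ⊆ A ∪ (fun v => v + -t n) ⁻¹' B := by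
    intro v hv
    by_contra hvn
    have hv1 := hv.1
    have hv2 := hv.2
    have ht1 := (ht n).1
    have ht2 := (ht n).2
    simp only [A, B, Set.mem_union, Set.mem_inter_iff, Set.mem_ofPred_eq, Set.mem_preimage,
      Set.mem_Icc, not_or, not_and, Real.norm_eq_abs] at hvn
    have e1 : |f (u n + v) - f (u n)| < ε / 2 := by
      by_contra hc
      exact hvn.1 (not_lt.1 hc) (by linarith) hv2
    have e2 : |f (u n + v) - f (u n + t n)| < ε / 2 := by
      by_contra hc
      refine hvn.2 ?_ (by linarith) (by linarith)
      rw [show u n + t n + (v + -t n) = u n + v by ring]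
      exact not_lt.1 hc
    have e3 := hft n
    rw [abs_lt] at e1 e2
    rcases le_abs.1 e3 with e3 | e3 <;> linarith [e1.1, e1.2, e2.1, e2.2]
  have hvol : volume (Set.Icc (1 : ℝ) 3) < 1 := by
    calc volume (Set.Icc (1 : ℝ) 3) ≤ volume A + volume ((fun v => v + -t n) ⁻¹' B) :=
          (measure_mono hsub).trans (measure_union_le _ _)
      _ = volume A + volume B := by rw [measure_preimage_add_right]
      _ < 2⁻¹ + 2⁻¹ := ENNReal.add_lt_add hn1 hn2
      _ = 1 := ENNReal.inv_two_add_inv_two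
  rw [Real.volume_Icc] at hvol
  norm_num at hvol

/-- Along the integers, `log ℓ` varies little between `n` and `2 n`. -/
theorem SlowlyVarying.eventually_abs_log_sub_lt {l : ℝ≥0 → ℝ} (hl : SlowlyVarying l) {ε : ℝ}
    (hε : 0 < ε) :
    ∀ᶠ n : ℕ in atTop, ∀ m : ℕ, n ≤ m → m ≤ 2 * n →
      |Real.log (l m) - Real.log (l n)| < ε := by
  set f : ℝ → ℝ := fun u => Real.log (l (Real.toNNReal (Real.exp u)))
  have hf : Measurable f :=
    Real.measurable_log.comp (hl.measurable.comp (by fun_prop))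
  have hx : Tendsto (fun u => Real.toNNReal (Real.exp u)) atTop atTop :=
    tendsto_real_toNNReal_atTop.comp Real.tendsto_exp_atTop
  have h : ∀ v, Tendsto (fun u => f (u + v) - f u) atTop (𝓝 0) := by
    intro v
    have hpos : 0 < Real.toNNReal (Real.exp v) := by simpa using Real.exp_pos v
    have := ((hl.tendsto _ hpos).comp hx).log one_ne_zero
    rw [Real.log_one] at this
    refine this.congr fun u => ?_
    simp only [Function.comp_apply, f]
    rw [Real.log_div (hl.pos _).ne' (hl.pos _).ne', ← Real.toNNReal_mul (Real.exp_pos _).le,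
      ← Real.exp_add, add_comm v u]
  have hlog : Tendsto (fun n : ℕ => Real.log n) atTop atTop :=
    Real.tendsto_log_atTop.comp tendsto_natCast_atTop_atTop
  filter_upwards [hlog.eventually (eventually_forall_increment_lt hf h hε),
    eventually_gt_atTop 0] with n hn hn0 m hnm hm
  have hn0' : (0 : ℝ) < n := by exact_mod_cast hn0
  have hm0' : (0 : ℝ) < m := by exact_mod_cast hn0.trans_le hnm
  have hnm' : (n : ℝ) ≤ m := by exact_mod_cast hnm
  have hm' : (m : ℝ) ≤ 2 * n := by exact_mod_cast hm
  have hf_nat : ∀ j : ℕ, (0 : ℝ) < j → f (Real.log j) = Real.log (l j) := by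
    intro j hj
    simp only [f]
    rw [Real.exp_log hj, Real.toNNReal_natCast]
  have := hn (Real.log m - Real.log n) ⟨sub_nonneg.2 (Real.log_le_log hn0' hnm'), ?_⟩
  · rwa [add_sub_cancel, hf_nat m hm0', hf_nat n hn0'] at this
  · have h1 : Real.log m ≤ Real.log 2 + Real.log n := by
      rw [← Real.log_mul two_ne_zero hn0'.ne']
      exact Real.log_le_log hm0' hm'
    have := Real.log_two_lt_d9
    linarith

/-! ### Regularly varying sequences -/

/-- The two consequences of regular variation of a positive sequence that are used:
`p (n - s) / p n → 1` for every fixed `s`, and `p m ≤ C p n` for large `n` and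
`n / 2 ≤ m ≤ n`. The value `p 0` is unconstrained up to nonnegativity. -/
structure LongTailed (p : ℕ → ℝ) : Prop where
  nonneg : ∀ n, 0 ≤ p n
  pos : ∀ n, 1 ≤ n → 0 < p n
  tendsto_sub : ∀ s, Tendsto (fun n => p (n - s) / p n) atTop (𝓝 1)
  bound : ∃ C, ∀ᶠ n in atTop, ∀ m, m ≤ n → n ≤ 2 * m → p m ≤ C * p n

theorem SlowlyVarying.longTailed {l : ℝ≥0 → ℝ} (hl : SlowlyVarying l) {α : ℝ} (hα : 0 ≤ α)
    {p : ℕ → ℝ} (hp0 : 0 ≤ p 0) (hp : ∀ i : ℕ, 1 ≤ i → p i = l i / (i : ℝ) ^ α) :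
    LongTailed p := by
  have hpos : ∀ n, 1 ≤ n → 0 < p n := fun n hn => by
    rw [hp n hn]
    have : (0 : ℝ) < n := by exact_mod_cast hn
    exact div_pos (hl.pos _) (Real.rpow_pos_of_pos this _)
  refine ⟨fun n => ?_, hpos, fun s => ?_, ?_⟩
  · rcases Nat.eq_zero_or_pos n with rfl | hn
    exacts [hp0, (hpos n hn).le]
  · have h1 : Tendsto (fun n : ℕ => Real.log (l ((n - s : ℕ) : ℝ≥0)) - Real.log (l (n : ℝ≥0)))
        atTop (𝓝 0) := by
      rw [Metric.tendsto_nhds]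
      intro ε hε
      filter_upwards [(tendsto_sub_atTop_nat s).eventually (hl.eventually_abs_log_sub_lt hε),
        eventually_ge_atTop (2 * s)] with n hn hn2
      rw [Real.dist_eq, sub_zero, abs_sub_comm]
      exact hn n (by omega) (by omega)
    have h2 : Tendsto (fun n : ℕ => ((n : ℝ) / ((n : ℝ) - s)) ^ α) atTop (𝓝 1) := by
      have h3 : Tendsto (fun n : ℕ => (n : ℝ) / ((n : ℝ) + (-s))) atTop (𝓝 1) :=
        tendsto_natCast_div_add_atTop (-(s : ℝ))
      have := h3.rpow_const (p := α) (Or.inl one_ne_zero)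
      rw [Real.one_rpow] at this
      exact this.congr fun n => by rw [sub_eq_add_neg]
    have h4 := (Real.continuous_exp.tendsto 0).comp h1
    rw [Real.exp_zero] at h4
    have h5 := h4.mul h2
    rw [one_mul] at h5
    refine h5.congr' ?_
    filter_upwards [eventually_gt_atTop s] with n hn
    have hns : (0 : ℝ) < (n : ℝ) - s := sub_pos.2 (by exact_mod_cast hn)
    have hn0 : (0 : ℝ) < n := by exact_mod_cast (by omega : 0 < n)
    rw [hp (n - s) (by omega), hp n (by omega), Function.comp_apply, Real.exp_sub,
      Real.exp_log (hl.pos _), Real.exp_log (hl.pos _), Real.div_rpow hn0.le hns.le,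
      Nat.cast_sub (R := ℝ) hn.le, div_mul_div_comm, div_div_div_eq, mul_comm (l n)]
  · refine ⟨Real.exp 1 * 2 ^ α, ?_⟩
    obtain ⟨M, hM⟩ := eventually_atTop.1 (hl.eventually_abs_log_sub_lt one_pos)
    filter_upwards [eventually_ge_atTop (2 * M), eventually_ge_atTop 1] with n hn hn1 m hmn hnm
    have h1 := hM m (by omega) n hmn hnm
    have hm0 : (0 : ℝ) < m := by exact_mod_cast (by omega : 0 < m)
    have hn0 : (0 : ℝ) < n := by exact_mod_cast hn1
    have h2 : l m ≤ Real.exp 1 * l n := by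
      rw [← Real.log_le_log_iff (hl.pos _) (mul_pos (Real.exp_pos _) (hl.pos _)),
        Real.log_mul (Real.exp_pos _).ne' (hl.pos _).ne', Real.log_exp]
      linarith [(abs_lt.1 h1).1]
    have h3 : (n : ℝ) ^ α ≤ 2 ^ α * (m : ℝ) ^ α := by
      rw [← Real.mul_rpow two_pos.le hm0.le]
      exact Real.rpow_le_rpow hn0.le (by exact_mod_cast hnm) hα
    rw [hp m (by omega), hp n hn1, div_le_iff₀ (Real.rpow_pos_of_pos hm0 _)]
    calc l m ≤ Real.exp 1 * l n := h2
      _ = Real.exp 1 * (l n / (n : ℝ) ^ α) * (n : ℝ) ^ α := by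
          have := (Real.rpow_pos_of_pos hn0 α).ne'
          field_simp
      _ ≤ Real.exp 1 * (l n / (n : ℝ) ^ α) * (2 ^ α * (m : ℝ) ^ α) := by
          refine mul_le_mul_of_nonneg_left h3 (mul_nonneg (Real.exp_pos _).le ?_)
          exact div_nonneg (hl.pos _).le (Real.rpow_nonneg hn0.le _)
      _ = _ := by ring

/-! ### Convolution powers of long-tailed sequences -/

namespace LongTailed

variable {p : ℕ → ℝ}

/-- One half of a convolution: the index `i` of the summable factor `u` stays in the lower half
of the range, where dominated convergence applies. -/
theorem tendsto_half_convolution (hp : LongTailed p) {u v : ℕ → ℝ} {c : ℝ}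
    (hu : ∀ i, 0 ≤ u i) (hus : Summable u) (hv : Tendsto (fun n => v n / p n) atTop (𝓝 c))
    (q : ℕ → ℕ → Prop) [∀ n i, Decidable (q n i)] (hq : ∀ n i, q n i → 2 * i ≤ n)
    (hq' : ∀ i, ∀ᶠ n in atTop, q n i) :
    Tendsto (fun n => (∑ i ∈ Finset.range (n + 1) with q n i, u i * v (n - i)) / p n) atTop
      (𝓝 (c * ∑' i, u i)) := by
  obtain ⟨C, hC⟩ := hp.bound
  have hvb : ∀ᶠ n in atTop, |v n / p n| ≤ |c| + 1 :=
    hv.abs.eventually_le_const (lt_add_one _)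
  obtain ⟨M, hM⟩ := eventually_atTop.1 hvb
  have hsum : ∀ n, (∑ i ∈ Finset.range (n + 1) with q n i, u i * v (n - i)) / p n =
      ∑' i, if q n i then u i * v (n - i) / p n else 0 := by
    intro n
    rw [Finset.sum_div, Finset.sum_filter, tsum_eq_sum]
    intro i hi
    rw [if_neg]
    intro h
    have := hq n i h
    exact hi (Finset.mem_range.2 (by omega))
  simp_rw [hsum]
  rw [mul_comm, ← tsum_mul_right]
  refine tendsto_tsum_of_dominated_convergence
    (bound := fun i => u i * ((|c| + 1) * |C|)) (hus.mul_right _) (fun i => ?_) ?_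
  · have h1 := ((hv.comp (tendsto_sub_atTop_nat i)).mul (hp.tendsto_sub i)).const_mul (u i)
    rw [mul_one] at h1
    refine h1.congr' ?_
    filter_upwards [hq' i, eventually_gt_atTop i] with n hn hni
    have := (hp.pos (n - i) (by omega)).ne'
    rw [if_pos hn, Function.comp_apply]
    field_simp
  · filter_upwards [hC, eventually_ge_atTop (2 * M), eventually_ge_atTop 1] with n hn hnM hn1 i
    have hpn := hp.pos n hn1
    have hnn : 0 ≤ u i * ((|c| + 1) * |C|) := mul_nonneg (hu i) (by positivity)
    split_ifs with h
    · have hi := hq n i h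
      have hpi := hp.pos (n - i) (by omega)
      have h1 := hM (n - i) (by omega)
      have h2 := hn (n - i) (by omega) (by omega)
      rw [abs_div, abs_of_pos hpi, div_le_iff₀ hpi] at h1
      rw [Real.norm_eq_abs, abs_div, abs_mul, abs_of_pos hpn, abs_of_nonneg (hu i),
        div_le_iff₀ hpn]
      calc u i * |v (n - i)| ≤ u i * ((|c| + 1) * (|C| * p n)) := by
            refine mul_le_mul_of_nonneg_left (h1.trans ?_) (hu i)
            refine mul_le_mul_of_nonneg_left (h2.trans ?_) (by positivity)
            exact mul_le_mul_of_nonneg_right (le_abs_self C) hpn.le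
        _ = _ := by ring
    · simpa using hnn

/-- In a convolution `∑ p i * h (n - i)` with `h ∼ c p`, either index is bounded while the other
one is close to `n`. -/
theorem tendsto_convolution (hp : LongTailed p) (hps : Summable p) {h : ℕ → ℝ} {c : ℝ}
    (hh : ∀ n, 0 ≤ h n) (hhs : Summable h) (hc : Tendsto (fun n => h n / p n) atTop (𝓝 c)) :
    Tendsto (fun n => (∑ ij ∈ Finset.HasAntidiagonal.antidiagonal n, p ij.1 * h ij.2) / p n) atTop
      (𝓝 (c * ∑' i, p i + ∑' i, h i)) := by
  have h1 := hp.tendsto_half_convolution hp.nonneg hps hc (fun n i => 2 * i ≤ n)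
    (fun _ _ => id) fun i => eventually_ge_atTop (2 * i)
  have hpp : Tendsto (fun n => p n / p n) atTop (𝓝 1) := by simpa using hp.tendsto_sub 0
  have h2 := hp.tendsto_half_convolution hh hhs hpp (fun n i => 2 * i < n)
    (fun _ _ => le_of_lt) fun i => eventually_gt_atTop (2 * i)
  have h3 := h1.add h2
  rw [one_mul] at h3
  refine h3.congr fun n => ?_
  rw [← add_div]
  congr 1
  rw [Finset.Nat.sum_antidiagonal_eq_sum_range_succ (fun i j => p i * h j),
    ← Finset.sum_filter_add_sum_filter_not (Finset.range (n + 1)) (fun i => 2 * i ≤ n)]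
  congr 1
  refine Finset.sum_bij' (fun i _ => n - i) (fun i _ => n - i) ?_ ?_ ?_ ?_ ?_ <;>
    simp only [Finset.mem_filter, Finset.mem_range] <;> intro i hi
  · omega
  · omega
  · omega
  · omega
  · rw [show n - (n - i) = i by omega, mul_comm]

open PowerSeries in
/-- The coefficients of the powers of the generating function of a summable long-tailed sequence
satisfy `[xⁿ] g ^ (k + 1) ∼ (k + 1) (∑ p) ^ k p n`. -/
theorem tendsto_coeff_pow (hp : LongTailed p) (hps : Summable p) (k : ℕ) :
    Tendsto (fun n => coeff n (PowerSeries.mk p ^ (k + 1)) / p n) atTop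
        (𝓝 ((k + 1) * (∑' i, p i) ^ k)) ∧
      (∀ n, 0 ≤ coeff n (PowerSeries.mk p ^ (k + 1))) ∧
      HasSum (fun n => coeff n (PowerSeries.mk p ^ (k + 1))) ((∑' i, p i) ^ (k + 1)) := by
  induction k with
  | zero =>
    refine ⟨?_, ?_, ?_⟩
    · simpa using hp.tendsto_sub 0
    · simpa using hp.nonneg
    · simpa using hps.hasSum
  | succ k ih =>
    obtain ⟨h1, h2, h3⟩ := ih
    have hmul : ∀ n, coeff n (PowerSeries.mk p ^ (k + 1 + 1)) =
        ∑ ij ∈ Finset.HasAntidiagonal.antidiagonal n,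
          p ij.1 * coeff ij.2 (PowerSeries.mk p ^ (k + 1)) := by
      intro n
      rw [pow_succ', coeff_mul]
      simp
    simp_rw [hmul]
    refine ⟨?_, fun n => Finset.sum_nonneg fun ij _ => mul_nonneg (hp.nonneg _) (h2 _), ?_⟩
    · convert hp.tendsto_convolution hps h2 h3.summable h1 using 2
      rw [h3.tsum_eq]
      push_cast
      ring
    · have e1 := hps.norm
      have e2 := h3.summable.norm
      rw [pow_succ' (∑' i, p i), ← h3.tsum_eq,
        tsum_mul_tsum_eq_tsum_sum_antidiagonal_of_summable_norm e1 e2]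
      exact (summable_norm_sum_mul_antidiagonal_of_summable_norm e1 e2).of_norm.hasSum

end LongTailed

/-! ### The weight of a tree -/

namespace PlaneTree

/-- Induction on plane trees through the list of subtrees of the root. -/
theorem induction_children {P : PlaneTree → Prop} (h : ∀ l, (∀ t ∈ l, P t) → P (node l)) :
    ∀ t, P t
  | node l => h l fun t _ => induction_children h t

/-- The product over the vertices of the weights `w` of their offspring numbers. -/
noncomputable def weight (w : ℕ → ℝ≥0∞) : PlaneTree → ℝ≥0∞
  | node l => w l.length * (l.map (weight w)).prod

theorem weight_node (w : ℕ → ℝ≥0∞) (l : List PlaneTree) :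
    weight w (node l) = w l.length * (l.map (weight w)).prod := by rw [weight]

theorem numVertices_node (l : List PlaneTree) :
    numVertices (node l) = 1 + (l.map numVertices).sum := by rw [numVertices]

theorem numInternal_node (l : List PlaneTree) :
    numInternal (node l) = (if l.isEmpty then 0 else 1) + (l.map numInternal).sum := by
  rw [numInternal]

theorem codes_node_iff (C : List ℕ → ℕ) (l : List PlaneTree) :
    Codes C (node l) ↔
      C [] = l.length ∧ ∀ i : Fin l.length, Codes (fun u => C (i :: u)) l[i] := by
  constructor
  · intro h
    cases h with
    | node _ _ h1 h2 => exact ⟨h1, fun i => h2 i i.2⟩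
  · rintro ⟨h1, h2⟩
    exact .node C l h1 fun i hi => h2 ⟨i, hi⟩

/-- The event that a given tree is generated is a cylinder: it prescribes the offspring numbers
of finitely many words. -/
theorem exists_cylinder (w : ℕ → ℝ≥0∞) (t : PlaneTree) :
    ∃ (V : Finset (List ℕ)) (c : List ℕ → ℕ),
      (∀ C : List ℕ → ℕ, Codes C t ↔ ∀ u ∈ V, C u = c u) ∧ ∏ u ∈ V, w (c u) = weight w t := by
  induction t using induction_children with
  | h l ih =>
    have ih' : ∀ i : Fin l.length, ∃ (V : Finset (List ℕ)) (c : List ℕ → ℕ),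
        (∀ C : List ℕ → ℕ, Codes C l[i] ↔ ∀ u ∈ V, C u = c u) ∧
          ∏ u ∈ V, w (c u) = weight w l[i] := fun i => ih _ (List.getElem_mem _)
    choose V c hV hw using ih'
    let emb : ℕ → List ℕ ↪ List ℕ := fun i => ⟨fun u => i :: u, List.cons_injective⟩
    let c' : List ℕ → ℕ := fun u => match u with
      | [] => l.length
      | i :: u => if h : i < l.length then c ⟨i, h⟩ u else 0
    let V' : Finset (List ℕ) := Finset.univ.biUnion fun i : Fin l.length => (V i).map (emb i)
    have hnil : [] ∉ V' := by simp [V', emb]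
    refine ⟨insert [] V', c', fun C => ?_, ?_⟩
    · rw [codes_node_iff]
      simp only [hV, Finset.forall_mem_insert, V', Finset.mem_biUnion, Finset.mem_univ, true_and,
        Finset.mem_map, forall_exists_index, and_imp]
      refine and_congr Iff.rfl ⟨?_, ?_⟩
      · rintro h _ i u hu rfl
        simpa [emb, c'] using h i u hu
      · intro h i u hu
        simpa [emb, c'] using h _ i u hu rfl
    · rw [Finset.prod_insert hnil, weight_node, Finset.prod_biUnion]
      · congr 1
        rw [← Fin.prod_univ_fun_getElem]
        refine Finset.prod_congr rfl fun i _ => ?_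
        rw [Finset.prod_map]
        refine Eq.trans ?_ (hw i)
        exact Finset.prod_congr rfl fun u _ => by simp [emb, c']
      · intro i _ j _ hij
        rw [Function.onFun, Finset.disjoint_left]
        simp only [Finset.mem_map, emb, Function.Embedding.coeFn_mk]
        rintro _ ⟨u, -, rfl⟩ ⟨v, -, h⟩
        exact hij (Fin.ext (List.cons.inj h).1.symm)

theorem infinitePi_codes (μ : PMF ℕ) (t : PlaneTree) :
    Measure.infinitePi (fun _ : List ℕ => μ.toMeasure) {C | Codes C t} = weight μ t := by
  obtain ⟨V, c, hV, hw⟩ := exists_cylinder μ t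
  have h : {C | Codes C t} = (V : Set (List ℕ)).pi fun u => {c u} := by
    ext C
    simp [hV, Set.mem_pi]
  rw [h, Measure.infinitePi_pi _ fun _ _ => measurableSet_singleton _, ← hw]
  exact Finset.prod_congr rfl fun u _ =>
    PMF.toMeasure_apply_singleton _ _ (measurableSet_singleton _)

end PlaneTree

theorem bgwLaw_apply (μ : PMF ℕ) (A : Set PlaneTree) :
    bgwLaw μ A = ∑' t, A.indicator (PlaneTree.weight μ) t := by
  rw [bgwLaw, Measure.sum_apply _ (MeasurableSet.of_discrete)]
  refine tsum_congr fun t => ?_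
  rw [Measure.smul_apply, PlaneTree.infinitePi_codes, Measure.dirac_apply, smul_eq_mul]
  by_cases h : t ∈ A <;> simp [h]

namespace PlaneTree

/-! ### The weight of a condensate -/

theorem weight_leaf (w : ℕ → ℝ≥0∞) : weight w leaf = w 0 := by simp [leaf, weight_node]

theorem weight_corolla (w : ℕ → ℝ≥0∞) (j : ℕ) : weight w (corolla j) = w j * w 0 ^ j := by
  simp [corolla, weight_node, weight_leaf]

theorem numVertices_leaf : numVertices leaf = 1 := by simp [leaf, numVertices_node]

theorem numVertices_corolla (j : ℕ) : numVertices (corolla j) = 1 + j := by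
  simp [corolla, numVertices_node, numVertices_leaf]

theorem numInternal_leaf : numInternal leaf = 0 := by simp [leaf, numInternal_node]

theorem numInternal_corolla {j : ℕ} (hj : 1 ≤ j) : numInternal (corolla j) = 1 := by
  have : j ≠ 0 := by omega
  simp [corolla, numInternal_node, numInternal_leaf, this]

theorem length_children_condensate {m : ℕ} (c : Fin (m + 1) → ℕ) (z : Fin m → ℕ) :
    (condensate c z).children.length = ∑ i, c i + m := by
  simp [condensate, children, Fin.sum_univ_succ, List.sum_ofFn, Function.comp_def,
    Finset.sum_add_distrib, add_assoc]

theorem numVertices_condensate {m : ℕ} (c : Fin (m + 1) → ℕ) (z : Fin m → ℕ) :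
    (condensate c z).numVertices = ∑ i, c i + ∑ i, z i + (m + 1) := by
  simp [condensate, numVertices_node, numVertices_leaf, numVertices_corolla, Fin.sum_univ_succ,
    List.sum_flatten, List.sum_ofFn, Function.comp_def, Finset.sum_add_distrib]
  ring

theorem numInternal_condensate {m : ℕ} {c : Fin (m + 1) → ℕ} {z : Fin m → ℕ}
    (hz : ∀ i, 1 ≤ z i) (hcm : 1 ≤ ∑ i, c i + m) :
    (condensate c z).numInternal = m + 1 := by
  have h := length_children_condensate c z
  rw [condensate, children] at h
  rw [condensate, numInternal_node, if_neg]
  · simp [numInternal_leaf, numInternal_corolla (hz _),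
      List.sum_flatten, Function.comp_def]
    ring
  · rw [List.isEmpty_iff, ← List.length_eq_zero_iff, h]
    omega

theorem weight_condensate (w : ℕ → ℝ≥0∞) {m : ℕ} (c : Fin (m + 1) → ℕ) (z : Fin m → ℕ) :
    weight w (condensate c z) =
      w (∑ i, c i + m) * w 0 ^ (∑ i, c i + ∑ i, z i) * ∏ i, w (z i) := by
  have h := length_children_condensate c z
  rw [condensate, children] at h
  rw [condensate, weight_node, h, mul_assoc]
  congr 1
  simp [weight_leaf, weight_corolla, List.prod_flatten, List.prod_ofFn, Function.comp_def,
    Finset.prod_mul_distrib, Finset.prod_pow_eq_pow_sum, Fin.sum_univ_succ, pow_add]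
  ring

/-- The leaf counts and the corner counts can be read off a condensate. -/
theorem condensate_inj {m : ℕ} {c c' : Fin (m + 1) → ℕ} {z z' : Fin m → ℕ}
    (hz : ∀ i, 1 ≤ z i) (hz' : ∀ i, 1 ≤ z' i) (h : condensate c z = condensate c' z') :
    c = c' ∧ z = z' := by
  have h1 := condensate_filter c z hz
  have h2 := condensate_splitOnP c z hz
  rw [h, condensate_filter c' z' hz'] at h1
  rw [h, condensate_splitOnP c' z' hz'] at h2
  refine ⟨(List.ofFn_injective h2).symm, funext fun i => ?_⟩
  have h3 := congrArg (fun t => t.children.length) (congrFun (List.ofFn_injective h1) i)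
  simpa [corolla, children] using h3.symm

end PlaneTree

/-- The number of compositions of `s` into `m + 1` nonnegative parts. -/
theorem encard_compositions (m s : ℕ) :
    {c : Fin (m + 1) → ℕ | ∑ i, c i = s}.encard = (s + m).choose m := by
  have h : {c : Fin (m + 1) → ℕ | ∑ i, c i = s} =
      (Finset.piAntidiag (Finset.univ : Finset (Fin (m + 1))) s : Set _) := by
    ext c; simp
  rw [h, Set.encard_coe_eq_coe_finsetCard, ← Finset.map_sym_eq_piAntidiag, Finset.card_map,
    Finset.sym_univ, Finset.card_univ, Sym.card_sym_eq_choose, Fintype.card_fin,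
    show m + 1 + s - 1 = s + m by omega, Nat.choose_symm_add]

/-! ### Total weight of forests -/

namespace PlaneTree

open Classical in
/-- The total weight of the ordered forests of `m` trees with `n` vertices and `k` internal nodes
altogether. -/
noncomputable def forestWeight (w : ℕ → ℝ≥0∞) (m n k : ℕ) : ℝ≥0∞ :=
  ∑' L : List PlaneTree,
    if L.length = m ∧ (L.map numVertices).sum = n ∧ (L.map numInternal).sum = k then
      (L.map (weight w)).prod else 0

theorem one_le_numVertices (t : PlaneTree) : 1 ≤ t.numVertices := by
  cases t with
  | node l => rw [numVertices_node]; omega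

theorem length_le_sum_numVertices (L : List PlaneTree) :
    L.length ≤ (L.map numVertices).sum := by
  induction L with
  | nil => simp
  | cons t L ih =>
    have := one_le_numVertices t
    simp only [List.length_cons, List.map_cons, List.sum_cons]
    omega

theorem forestWeight_zero_le (w : ℕ → ℝ≥0∞) (s k : ℕ) :
    forestWeight w 0 s k ≤ if s = 0 ∧ k = 0 then 1 else 0 := by
  rw [forestWeight, tsum_eq_single []]
  · simp [eq_comm (a := 0)]
  · intro L hL
    refine if_neg fun h => hL (List.length_eq_zero_iff.1 h.1)

open Classical in
/-- Removing the root of the first tree of a forest. -/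
theorem forestWeight_succ_le_tsum (w : ℕ → ℝ≥0∞) (m n k : ℕ) :
    forestWeight w (m + 1) (n + 1) k ≤ ∑' j, w j * ∑' L : List PlaneTree,
      if L.length = m + j ∧ (L.map numVertices).sum = n ∧
        (if j = 0 then 0 else 1) + (L.map numInternal).sum = k then
        (L.map (weight w)).prod else 0 := by
  -- The number of children of the removed root, recorded in the first component, makes it possible
  -- to recover the forest.
  set g : ℕ × List PlaneTree → ℝ≥0∞ := fun x => w x.1 *
    if x.2.length = m + x.1 ∧ (x.2.map numVertices).sum = n ∧
      (if x.1 = 0 then 0 else 1) + (x.2.map numInternal).sum = k then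
      (x.2.map (weight w)).prod else 0 with hg
  have hR : (∑' j, w j * ∑' L : List PlaneTree,
      if L.length = m + j ∧ (L.map numVertices).sum = n ∧
        (if j = 0 then 0 else 1) + (L.map numInternal).sum = k then
        (L.map (weight w)).prod else 0) = ∑' x, g x := by
    rw [ENNReal.tsum_prod']
    exact tsum_congr fun j => ENNReal.tsum_mul_left.symm
  rw [hR, forestWeight]
  set f : List PlaneTree → ℝ≥0∞ := fun L =>
    if L.length = m + 1 ∧ (L.map numVertices).sum = n + 1 ∧ (L.map numInternal).sum = k then
      (L.map (weight w)).prod else 0 with hf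
  have hsupp : Function.support f ⊆ {L | L ≠ []} := by
    intro L hL h0
    subst h0
    simp [f] at hL
  rw [← tsum_subtype_eq_of_support_subset hsupp]
  let φ : {L : List PlaneTree | L ≠ []} → ℕ × List PlaneTree := fun L =>
    ((L.1.head L.2).children.length, (L.1.head L.2).children ++ L.1.tail)
  have hfg : ∀ L, f L.1 = g (φ L) := by
    rintro ⟨L, hL⟩
    obtain ⟨⟨c⟩, r, rfl⟩ := List.exists_cons_of_ne_nil hL
    simp only [hf, hg, φ, List.head_cons, List.tail_cons, children, List.length_cons,
      List.map_cons, List.sum_cons, List.prod_cons, numVertices_node, numInternal_node,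
      weight_node, List.length_append, List.map_append, List.sum_append, List.prod_append,
      List.isEmpty_iff, ← List.length_eq_zero_iff, mul_ite, mul_zero, mul_assoc]
    refine if_congr ?_ rfl rfl
    split_ifs <;> omega
  have hφ : Function.Injective φ := by
    rintro ⟨L, hL⟩ ⟨L', hL'⟩ h
    obtain ⟨⟨c⟩, r, rfl⟩ := List.exists_cons_of_ne_nil hL
    obtain ⟨⟨c'⟩, r', rfl⟩ := List.exists_cons_of_ne_nil hL'
    simp only [φ, List.head_cons, List.tail_cons, children, Prod.mk.injEq] at h
    obtain ⟨rfl, rfl⟩ := List.append_inj h.2 h.1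
    rfl
  calc ∑' L : {L : List PlaneTree | L ≠ []}, f L = ∑' L, g (φ L) := tsum_congr hfg
    _ ≤ _ := ENNReal.tsum_comp_le_tsum_of_injective hφ g

theorem forestWeight_succ_le_zero (w : ℕ → ℝ≥0∞) (m n : ℕ) :
    forestWeight w (m + 1) (n + 1) 0 ≤ w 0 * forestWeight w m n 0 := by
  refine (forestWeight_succ_le_tsum w m n 0).trans_eq ?_
  rw [tsum_eq_single 0]
  · simp [forestWeight]
  · intro j hj
    simp [hj]

theorem forestWeight_succ_le_succ (w : ℕ → ℝ≥0∞) (m s k : ℕ) :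
    forestWeight w (m + 1) (m + s + 1) (k + 1) ≤ w 0 * forestWeight w m (m + s) (k + 1) +
      ∑ ij ∈ Finset.HasAntidiagonal.antidiagonal s,
        (if ij.1 = 0 then 0 else w ij.1 * forestWeight w (m + ij.1) (m + ij.1 + ij.2) k) := by
  refine (forestWeight_succ_le_tsum w m (m + s) (k + 1)).trans_eq ?_
  rw [Finset.Nat.sum_antidiagonal_eq_sum_range_succ
      (fun i j => if i = 0 then 0 else w i * forestWeight w (m + i) (m + i + j) k),
    tsum_eq_sum (s := Finset.range s.succ), Finset.sum_range_succ', Finset.sum_range_succ',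
    add_comm]
  · congr 1
    · simp [forestWeight]
    · rw [if_pos rfl, add_zero]
      refine Finset.sum_congr rfl fun i hi => ?_
      rw [if_neg (Nat.succ_ne_zero i), forestWeight]
      have := Finset.mem_range.1 hi
      congr 1
      refine tsum_congr fun L => if_congr ?_ rfl rfl
      omega
  · intro j hj
    have hj' : s < j := by simpa using hj
    refine mul_eq_zero_of_right _ (ENNReal.tsum_eq_zero.2 fun L => if_neg ?_)
    rintro ⟨h1, h2, -⟩
    have := length_le_sum_numVertices L
    omega

end PlaneTree

open PowerSeries in
/-- Comparing coefficients in `x (gᵏ⁺¹)' = (k + 1) (x g') gᵏ`. -/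
theorem succ_mul_sum_antidiagonal_coeff_pow (p : ℕ → ℝ) (s k : ℕ) :
    (k + 1) * ∑ ij ∈ Finset.HasAntidiagonal.antidiagonal s,
      (ij.1 * p ij.1) * coeff ij.2 (PowerSeries.mk p ^ k) =
      s * coeff s (PowerSeries.mk p ^ (k + 1)) := by
  have hX : ∀ (f : PowerSeries ℝ) (n : ℕ), coeff n (X * derivative ℝ f) = n * coeff n f := by
    intro f n
    cases n with
    | zero => simp
    | succ n => rw [coeff_succ_X_mul, coeff_derivative, mul_comm]; push_cast; rfl
  have h : X * derivative ℝ (PowerSeries.mk p ^ (k + 1)) =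
      ((k + 1 : ℕ) : PowerSeries ℝ) *
        ((X * derivative ℝ (PowerSeries.mk p)) * PowerSeries.mk p ^ k) := by
    rw [Derivation.leibniz_pow]
    simp
    ring
  rw [← hX, h, ← nsmul_eq_mul, map_nsmul, coeff_mul, nsmul_eq_mul]
  push_cast
  congr 1
  refine Finset.sum_congr rfl fun ij _ => ?_
  rw [hX, coeff_mk]

open PowerSeries in
/-- The closed form (Kemperman's formula) for the total weight of the forests of `m` trees with
`m + s` vertices and `k` internal nodes, where `q` is the weight of a leaf and `p j` that of a
node with `j ≥ 1` children. -/
noncomputable def kemperman (q : ℝ) (p : ℕ → ℝ) (m s k : ℕ) : ℝ :=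
  if m = 0 then (if s = 0 ∧ k = 0 then 1 else 0) else
    m / (m + s) * (m + s).choose k * q ^ (m + s - k) * coeff s (PowerSeries.mk p ^ k)

theorem kemperman_succ_zero (q : ℝ) (p : ℕ → ℝ) (m s : ℕ) :
    kemperman q p (m + 1) s 0 = q * kemperman q p m s 0 := by
  rcases Nat.eq_zero_or_pos s with rfl | hs
  · rcases Nat.eq_zero_or_pos m with rfl | hm
    · simp [kemperman]
    · have h1 : (m : ℝ) ≠ 0 := by exact_mod_cast hm.ne'
      have h2 : (m : ℝ) + 1 ≠ 0 := by positivity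
      simp [kemperman, hm.ne', h1, h2, pow_succ']
  · simp [kemperman, hs.ne', PowerSeries.coeff_one]

theorem kemperman_of_pos (q : ℝ) (p : ℕ → ℝ) {m s k : ℕ} (h : 0 < m ∨ 0 < s) :
    kemperman q p m s k = m / (m + s) * (m + s).choose k * q ^ (m + s - k) *
      PowerSeries.coeff s (PowerSeries.mk p ^ k) := by
  rcases Nat.eq_zero_or_pos m with rfl | hm
  · have hs : s ≠ 0 := by omega
    simp [kemperman, hs]
  · rw [kemperman, if_neg hm.ne']

/-- The recursion of the closed form when the root of the first tree is removed. The sum over its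
number of children is evaluated with the derivative identity
`succ_mul_sum_antidiagonal_coeff_pow`, and what remains is an identity between binomial
coefficients. -/
theorem kemperman_succ_succ (q : ℝ) {p : ℕ → ℝ} (hp0 : p 0 = 0) (m s k : ℕ) :
    kemperman q p (m + 1) s (k + 1) = q * kemperman q p m s (k + 1) +
      ∑ ij ∈ Finset.HasAntidiagonal.antidiagonal s,
        p ij.1 * kemperman q p (m + ij.1) ij.2 k := by
  rcases Nat.eq_zero_or_pos (m + s) with h0 | h0
  · obtain ⟨rfl, rfl⟩ : m = 0 ∧ s = 0 := by omega
    simp [kemperman, hp0]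
  have hsum : ∑ ij ∈ Finset.HasAntidiagonal.antidiagonal s,
        p ij.1 * kemperman q p (m + ij.1) ij.2 k =
      (m + s).choose k * q ^ (m + s - k) / (m + s) *
        (m * PowerSeries.coeff s (PowerSeries.mk p ^ (k + 1)) +
          ∑ ij ∈ Finset.HasAntidiagonal.antidiagonal s,
            (ij.1 * p ij.1) * PowerSeries.coeff ij.2 (PowerSeries.mk p ^ k)) := by
    rw [pow_succ', PowerSeries.coeff_mul, Finset.mul_sum, ← Finset.sum_add_distrib,
      Finset.mul_sum]
    refine Finset.sum_congr rfl fun ij hij => ?_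
    obtain ⟨i, j⟩ := ij
    obtain rfl : i + j = s := by simpa using hij
    rw [PowerSeries.coeff_mk]
    rcases Nat.eq_zero_or_pos i with rfl | hi
    · simp [hp0]
    · rw [kemperman_of_pos q p (Or.inl (by omega)), add_assoc m i j]
      push_cast
      ring
  rw [hsum, kemperman_of_pos q p (by omega), kemperman_of_pos q p (by omega)]
  have hder := succ_mul_sum_antidiagonal_coeff_pow p s k
  set A := PowerSeries.coeff s (PowerSeries.mk p ^ (k + 1))
  set D := ∑ ij ∈ Finset.HasAntidiagonal.antidiagonal s,
            (ij.1 * p ij.1) * PowerSeries.coeff ij.2 (PowerSeries.mk p ^ k)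
  have hk : (k : ℝ) + 1 ≠ 0 := by positivity
  have hD : D = s * A / (k + 1) := by rw [eq_div_iff hk, mul_comm, hder]
  have hq : q * ((m + s).choose (k + 1) * q ^ (m + s - (k + 1))) =
      (m + s).choose (k + 1) * q ^ (m + s - k) := by
    rcases lt_or_ge (m + s) (k + 1) with h | h
    · simp [Nat.choose_eq_zero_of_lt h]
    · rw [show m + s - k = (m + s - (k + 1)) + 1 by omega, pow_succ]
      ring
  have hN : (m : ℝ) + s ≠ 0 := by exact_mod_cast h0.ne'
  have hN1 : (m : ℝ) + s + 1 ≠ 0 := by positivity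
  have hc1 : ((m + s + 1 : ℕ) : ℝ) * (m + s).choose k = (m + s + 1).choose (k + 1) * (k + 1) := by
    exact_mod_cast Nat.add_one_mul_choose_eq (m + s) k
  have hc2 : ((m + s + 1).choose (k + 1) : ℝ) = (m + s).choose k + (m + s).choose (k + 1) := by
    exact_mod_cast Nat.choose_succ_succ (m + s) k
  have hy : ((m + s).choose (k + 1) : ℝ) = (m + s - k) * (m + s).choose k / (k + 1) := by
    rw [eq_div_iff hk]
    rw [hc2] at hc1
    push_cast at hc1
    linarith
  have e1 : q * ((m : ℝ) / (m + s) * (m + s).choose (k + 1) * q ^ (m + s - (k + 1)) * A) =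
      m / (m + s) * ((m + s).choose (k + 1) * q ^ (m + s - k)) * A := by
    rw [← hq]; ring
  rw [e1, hD, show m + 1 + s - (k + 1) = m + s - k by omega, show m + 1 + s = m + s + 1 by omega,
    hc2, hy]
  push_cast
  rw [show (m : ℝ) + 1 + s = m + s + 1 by ring]
  field_simp
  ring

namespace PlaneTree

/-- The total weight of forests obeys, as an inequality, the recursion of the closed form on the
number `m + s` of vertices. -/
theorem forestWeight_le_kemperman {w : ℕ → ℝ≥0∞} {q : ℝ} {p : ℕ → ℝ} (hq : 0 ≤ q)
    (hp : ∀ j, 0 ≤ p j) (hp0 : p 0 = 0) (hwq : w 0 = ENNReal.ofReal q)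
    (hwp : ∀ j, 1 ≤ j → w j = ENNReal.ofReal (p j)) (N : ℕ) :
    ∀ m s k, m + s = N → 0 ≤ kemperman q p m s k ∧
      forestWeight w m (m + s) k ≤ ENNReal.ofReal (kemperman q p m s k) := by
  induction N with
  | zero =>
    intro m s k h
    obtain ⟨rfl, rfl⟩ : m = 0 ∧ s = 0 := by omega
    have := forestWeight_zero_le w 0 k
    refine ⟨by simp only [kemperman]; split_ifs <;> simp, this.trans ?_⟩
    simp only [kemperman]; split_ifs <;> simp
  | succ N ih =>
    intro m s k h
    rcases m with - | m
    · rw [zero_add]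
      have := forestWeight_zero_le w s k
      refine ⟨by simp only [kemperman]; split_ifs <;> simp, this.trans ?_⟩
      simp only [kemperman]; split_ifs <;> simp
    · rw [show m + 1 + s = m + s + 1 by omega]
      rcases k with - | k
      · obtain ⟨h1, h2⟩ := ih m s 0 (by omega)
        rw [kemperman_succ_zero]
        refine ⟨mul_nonneg hq h1, (forestWeight_succ_le_zero w m (m + s)).trans ?_⟩
        rw [ENNReal.ofReal_mul hq, hwq]
        gcongr
      · obtain ⟨h1, h2⟩ := ih m s (k + 1) (by omega)
        rw [kemperman_succ_succ q hp0]
        have h3 : ∀ ij ∈ Finset.HasAntidiagonal.antidiagonal s,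
            0 ≤ p ij.1 * kemperman q p (m + ij.1) ij.2 k := by
          intro ij hij
          rw [Finset.HasAntidiagonal.mem_antidiagonal] at hij
          exact mul_nonneg (hp _) (ih _ _ _ (by omega)).1
        refine ⟨add_nonneg (mul_nonneg hq h1) (Finset.sum_nonneg h3),
          (forestWeight_succ_le_succ w m s k).trans ?_⟩
        rw [ENNReal.ofReal_add (mul_nonneg hq h1) (Finset.sum_nonneg h3),
          ENNReal.ofReal_sum_of_nonneg h3, ENNReal.ofReal_mul hq, hwq]
        refine add_le_add (by gcongr) (Finset.sum_le_sum fun ij hij => ?_)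
        rw [Finset.HasAntidiagonal.mem_antidiagonal] at hij
        split_ifs with hi
        · exact zero_le
        · rw [ENNReal.ofReal_mul (hp _), hwp _ (by omega)]
          gcongr
          exact (ih _ _ _ (by omega)).2

end PlaneTree

/-- The upper bound for the partition function of the conditioned tree. -/
theorem bgwLaw_treesWith_le (μ : PMF ℕ) {p : ℕ → ℝ} (hp0 : p 0 = 0)
    (hp : ∀ j, 1 ≤ j → p j = (μ j).toReal) (s k : ℕ) :
    bgwLaw μ (PlaneTree.treesWith (s + 1) k) ≤
      ENNReal.ofReal ((s + 1).choose k / (s + 1) * (μ 0).toReal ^ (s + 1 - k) *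
        PowerSeries.coeff s (PowerSeries.mk p ^ k)) := by
  have hnn : ∀ j, 0 ≤ p j := by
    intro j
    rcases Nat.eq_zero_or_pos j with rfl | hj
    · exact hp0.ge
    · rw [hp j hj]; exact ENNReal.toReal_nonneg
  have h := (PlaneTree.forestWeight_le_kemperman (w := μ) ENNReal.toReal_nonneg hnn hp0
    (ENNReal.ofReal_toReal (μ.apply_ne_top 0)).symm
    (fun j hj => by rw [hp j hj, ENNReal.ofReal_toReal (μ.apply_ne_top j)]) (1 + s) 1 s k rfl).2
  have e : kemperman (μ 0).toReal p 1 s k = (s + 1).choose k / (s + 1) *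
      (μ 0).toReal ^ (s + 1 - k) * PowerSeries.coeff s (PowerSeries.mk p ^ k) := by
    rw [kemperman_of_pos _ _ (by omega), add_comm 1 s]
    push_cast
    ring
  rw [e] at h
  refine le_trans ?_ h
  rw [bgwLaw_apply, PlaneTree.forestWeight]
  have hinj : Function.Injective fun t : PlaneTree => [t] := fun t t' h => by simpa using h
  refine le_trans (le_of_eq ?_) (ENNReal.tsum_comp_le_tsum_of_injective hinj _)
  refine tsum_congr fun t => ?_
  simp only [Set.indicator, PlaneTree.treesWith, add_comm 1 s]
  simp only [Set.mem_ofPred_eq, List.length_singleton, List.map_cons, List.map_nil,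
    List.sum_singleton, List.prod_singleton, true_and]
  congr

/-! ### Comparison of the two laws -/

/-- For two probability measures a one-sided bound suffices, since it applies to complements. -/
theorem tvDist_le_of_forall_le_add {α : Type*} [MeasurableSpace α] {P Q : Measure α}
    [IsProbabilityMeasure P] [IsProbabilityMeasure Q] {δ : ℝ≥0∞} (hδ : δ ≠ ∞)
    (h : ∀ A, MeasurableSet A → Q A ≤ P A + δ) : tvDist P Q ≤ δ.toReal := by
  have hreal : ∀ A, MeasurableSet A → Q.real A ≤ P.real A + δ.toReal := by
    intro A hA
    rw [measureReal_def, measureReal_def, ← ENNReal.toReal_add (measure_ne_top _ _) hδ]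
    exact ENNReal.toReal_mono (ENNReal.add_ne_top.2 ⟨measure_ne_top _ _, hδ⟩) (h A hA)
  have : Nonempty {A : Set α // MeasurableSet A} := ⟨⟨∅, .empty⟩⟩
  refine ciSup_le fun A => ?_
  have h1 := hreal A.1 A.2
  have h2 := hreal A.1ᶜ A.2.compl
  rw [probReal_compl_eq_one_sub A.2, probReal_compl_eq_one_sub A.2] at h2
  rw [abs_le]
  constructor <;> linarith

theorem tvDist_nonneg {α : Type*} [MeasurableSpace α] (P Q : Measure α) : 0 ≤ tvDist P Q :=
  Real.iSup_nonneg fun _ => abs_nonneg _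

theorem isProbabilityMeasure_posLaw {μ : PMF ℕ} (h1 : μ 1 ≠ 0) :
    IsProbabilityMeasure (posLaw μ) := by
  refine cond_isProbabilityMeasure fun h => h1 ?_
  rw [← μ.toMeasure_apply_singleton 1 (measurableSet_singleton 1)]
  exact measure_mono_null (by simp) h

theorem posLaw_singleton_zero (μ : PMF ℕ) : posLaw μ {0} = 0 := by
  rw [posLaw, cond_apply MeasurableSet.of_discrete]
  have : {j : ℕ | 1 ≤ j} ∩ {0} = ∅ := by ext; simp
  simp [this]

/-- The conditional law of the condensate given the offspring numbers `z` of its non-root internal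
nodes. -/
noncomputable def graftLaw (n : ℕ) (a : PlaneTree) {m : ℕ} (z : Fin m → ℕ) : Measure PlaneTree :=
  if (∑ i, z i) + (m + 1) ≤ n then
    (uniformOn {c : Fin (m + 1) → ℕ | ∑ i, c i = n - (m + 1) - ∑ i, z i}).map
      fun c => PlaneTree.condensate c z
  else Measure.dirac a

theorem condensateLaw_succ (μ : PMF ℕ) (n m : ℕ) (a : PlaneTree) :
    condensateLaw μ n (m + 1) a =
      (Measure.pi fun _ : Fin m => posLaw μ).bind (graftLaw n a) := rfl

theorem finite_compositions (m s : ℕ) : {c : Fin (m + 1) → ℕ | ∑ i, c i = s}.Finite := by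
  rw [← Set.encard_ne_top_iff, encard_compositions]
  exact ENat.natCast_ne_top _

instance isProbabilityMeasure_graftLaw (n : ℕ) (a : PlaneTree) {m : ℕ} (z : Fin m → ℕ) :
    IsProbabilityMeasure (graftLaw n a z) := by
  rw [graftLaw]
  split_ifs
  · have := isProbabilityMeasure_uniformOn (finite_compositions m (n - (m + 1) - ∑ i, z i))
      ⟨Pi.single 0 (n - (m + 1) - ∑ i, z i), by simp⟩
    exact Measure.isProbabilityMeasure_map Measurable.of_discrete.aemeasurable
  · infer_instance

open Classical in
theorem graftLaw_apply {n m : ℕ} (a : PlaneTree) {z : Fin m → ℕ}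
    (hz : (∑ i, z i) + (m + 1) ≤ n) (A : Set PlaneTree) :
    graftLaw n a z A = ((n - 1 - ∑ i, z i).choose m : ℝ≥0∞)⁻¹ * ∑' c : Fin (m + 1) → ℕ,
      if ∑ i, c i = n - (m + 1) - ∑ i, z i ∧ PlaneTree.condensate c z ∈ A then 1 else 0 := by
  rw [graftLaw, if_pos hz, Measure.map_apply Measurable.of_discrete MeasurableSet.of_discrete,
    uniformOn, cond_apply MeasurableSet.of_discrete, Measure.count_apply MeasurableSet.of_discrete,
    encard_compositions, show n - (m + 1) - ∑ i, z i + m = n - 1 - ∑ i, z i by omega]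
  congr 1
  rw [Measure.count, Measure.sum_apply _ MeasurableSet.of_discrete]
  refine tsum_congr fun c => ?_
  rw [Measure.dirac_apply, Set.indicator_apply]
  exact if_congr Iff.rfl rfl rfl

/-- The ratio between the probabilities that the conditioned tree and the condensate are equal to
a given condensate, whose non-root internal nodes have offspring numbers `z`. It does not depend
on the corner counts. -/
noncomputable def massRatio (μ : PMF ℕ) (n : ℕ) {m : ℕ} (z : Fin m → ℕ) : ℝ≥0∞ :=
  if (∑ i, z i) + (m + 1) ≤ n then
    (bgwLaw μ (PlaneTree.treesWith n (m + 1)))⁻¹ * (μ 0 ^ (n - (m + 1)) * (1 - μ 0) ^ m *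
      μ (n - 1 - ∑ i, z i) * (n - 1 - ∑ i, z i).choose m)
  else 0

open Classical in
/-- For each `z` with positive entries this is an equality as soon as the corners can be filled:
the number of compositions and the factor `(1 - μ 0) ^ m` cancel. -/
theorem massRatio_mul_graftLaw_le {μ : PMF ℕ} (h1 : μ 1 ≠ 0) {n m : ℕ} (hn : 2 ≤ n) (a : PlaneTree)
    (A : Set PlaneTree) (z : Fin m → ℕ) :
    massRatio μ n z * graftLaw n a z A * (Measure.pi fun _ : Fin m => posLaw μ) {z} ≤
      ∑' c : Fin (m + 1) → ℕ,
        if (∀ i, 1 ≤ z i) ∧ PlaneTree.condensate c z ∈ PlaneTree.treesWith n (m + 1) ∩ A then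
          (bgwLaw μ (PlaneTree.treesWith n (m + 1)))⁻¹ *
            PlaneTree.weight μ (PlaneTree.condensate c z) else 0 := by
  have := isProbabilityMeasure_posLaw h1
  rw [Measure.pi_singleton]
  by_cases hz : ∀ i, 1 ≤ z i
  swap
  · push Not at hz
    obtain ⟨i, hi⟩ := hz
    rw [Finset.prod_eq_zero (Finset.mem_univ i), mul_zero]
    · exact zero_le
    · rw [show z i = 0 by omega, posLaw_singleton_zero]
  by_cases hzn : (∑ i, z i) + (m + 1) ≤ n
  swap
  · simp [massRatio, hzn]
  set S := ∑ i, z i with hS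
  set W := (bgwLaw μ (PlaneTree.treesWith n (m + 1)))⁻¹
  have hμ0 : 1 - μ 0 ≠ 0 := by
    rw [Ne, tsub_eq_zero_iff_le, not_le]
    refine lt_of_lt_of_le (ENNReal.lt_add_right (μ.apply_ne_top 0) h1) ?_
    rw [← μ.tsum_coe]
    refine le_trans ?_ (ENNReal.sum_le_tsum {0, 1})
    simp
  have hμ0' : 1 - μ 0 ≠ ∞ := ENNReal.sub_ne_top ENNReal.one_ne_top
  have hprod : (1 - μ 0) ^ m * ∏ i, posLaw μ {z i} = ∏ i, μ (z i) := by
    have : (1 - μ 0) ^ m = ∏ _i : Fin m, (1 - μ 0) := by simp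
    rw [this, ← Finset.prod_mul_distrib]
    exact Finset.prod_congr rfl fun i _ => by
      rw [posLaw_singleton μ (hz i), ENNReal.mul_div_cancel hμ0 hμ0']
  have hN : ((n - 1 - S).choose m : ℝ≥0∞) ≠ 0 := by
    exact_mod_cast (Nat.choose_pos (by omega)).ne'
  have hNN : ((n - 1 - S).choose m : ℝ≥0∞) * ((n - 1 - S).choose m : ℝ≥0∞)⁻¹ = 1 :=
    ENNReal.mul_inv_cancel hN (ENNReal.natCast_ne_top _)
  rw [massRatio, if_pos hzn, graftLaw_apply a hzn]
  calc _ = (W * (μ 0 ^ (n - (m + 1)) * μ (n - 1 - S) *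
          (((n - 1 - S).choose m : ℝ≥0∞) * ((n - 1 - S).choose m : ℝ≥0∞)⁻¹) *
          ((1 - μ 0) ^ m * ∏ i, posLaw μ {z i}))) * ∑' c : Fin (m + 1) → ℕ,
          if ∑ i, c i = n - (m + 1) - S ∧ PlaneTree.condensate c z ∈ A then 1 else 0 := by
        ring
    _ ≤ _ := by
        rw [hNN, mul_one, hprod, ← ENNReal.tsum_mul_left]
        refine ENNReal.tsum_le_tsum fun c => ?_
        by_cases hc : ∑ i, c i = n - (m + 1) - S ∧ PlaneTree.condensate c z ∈ A
        · have hT : PlaneTree.condensate c z ∈ PlaneTree.treesWith n (m + 1) := by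
            refine ⟨?_, PlaneTree.numInternal_condensate hz ?_⟩
            · rw [PlaneTree.numVertices_condensate]; omega
            · rcases Nat.eq_zero_or_pos m with rfl | hm
              · simp only [Finset.univ_eq_empty, Finset.sum_empty] at hS
                omega
              · omega
          rw [if_pos hc, if_pos ⟨hz, hT, hc.2⟩, mul_one, PlaneTree.weight_condensate]
          rw [show ∑ i, c i + ∑ i, z i = n - (m + 1) by omega,
            show ∑ i, c i + m = n - 1 - S by omega, mul_comm (μ 0 ^ _)]
        · rw [if_neg hc, mul_zero]
          exact zero_le

/-- The masses that the conditioned tree gives to the condensates in `A`, which are distinct for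
distinct parameters, add up to at most the mass of `A`. -/
theorem lintegral_massRatio_mul_graftLaw_le {μ : PMF ℕ} (h1 : μ 1 ≠ 0) {n : ℕ} (m : ℕ)
    (hn : 2 ≤ n) (a : PlaneTree) (A : Set PlaneTree) :
    ∫⁻ z, massRatio μ n z * graftLaw n a z A ∂(Measure.pi fun _ : Fin m => posLaw μ) ≤
      condBGWLaw μ n (m + 1) A := by
  classical
  rw [lintegral_countable', condBGWLaw, cond_apply MeasurableSet.of_discrete,
    bgwLaw_apply μ (_ ∩ A), ← ENNReal.tsum_mul_left]
  refine (ENNReal.tsum_le_tsum fun z => massRatio_mul_graftLaw_le h1 hn a A z).trans ?_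
  set B := PlaneTree.treesWith n (m + 1) ∩ A
  set W := (bgwLaw μ (PlaneTree.treesWith n (m + 1)))⁻¹
  set f : (Fin m → ℕ) × (Fin (m + 1) → ℕ) → ℝ≥0∞ := fun x =>
    if (∀ i, 1 ≤ x.1 i) ∧ PlaneTree.condensate x.2 x.1 ∈ B then
      W * PlaneTree.weight μ (PlaneTree.condensate x.2 x.1) else 0 with hf
  rw [← ENNReal.tsum_prod' (f := f)]
  have hsupp : Function.support f ⊆ {x | ∀ i, 1 ≤ x.1 i} := by
    intro x hx
    by_contra hc
    exact hx (if_neg fun h => hc h.1)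
  rw [← tsum_subtype_eq_of_support_subset hsupp]
  have hinj : Function.Injective fun x : {x : (Fin m → ℕ) × (Fin (m + 1) → ℕ) | ∀ i, 1 ≤ x.1 i} =>
      PlaneTree.condensate x.1.2 x.1.1 := by
    rintro ⟨⟨z, c⟩, hz⟩ ⟨⟨z', c'⟩, hz'⟩ h
    obtain ⟨rfl, rfl⟩ := PlaneTree.condensate_inj hz hz' h
    rfl
  refine le_trans (ENNReal.tsum_le_tsum fun x => ?_)
    (ENNReal.tsum_comp_le_tsum_of_injective hinj _)
  simp only [hf, Set.indicator]
  split_ifs with h h' <;> first | exact le_rfl | exact zero_le | exact absurd h.2 h'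

/-- Writing `1 ≤ r + (1 - r)` for the mass ratio `r`: the condensate exceeds the conditioned tree
by at most the mean deficit of the mass ratio. -/
theorem condensateLaw_le {μ : PMF ℕ} (h1 : μ 1 ≠ 0) {n : ℕ} (m : ℕ) (hn : 2 ≤ n) (a : PlaneTree)
    (A : Set PlaneTree) :
    condensateLaw μ n (m + 1) a A ≤ condBGWLaw μ n (m + 1) A +
      ∫⁻ z, (1 - massRatio μ n z) ∂(Measure.pi fun _ : Fin m => posLaw μ) := by
  rw [condensateLaw_succ, Measure.bind_apply MeasurableSet.of_discrete
    Measurable.of_discrete.aemeasurable]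
  refine le_trans ?_ (add_le_add_left (lintegral_massRatio_mul_graftLaw_le h1 m hn a A) _)
  rw [← lintegral_add_left Measurable.of_discrete]
  refine lintegral_mono fun z => ?_
  calc graftLaw n a z A = 1 * graftLaw n a z A := (one_mul _).symm
    _ ≤ (massRatio μ n z + (1 - massRatio μ n z)) * graftLaw n a z A := by
        gcongr; exact le_add_tsub
    _ = massRatio μ n z * graftLaw n a z A + (1 - massRatio μ n z) * graftLaw n a z A :=
        add_mul _ _ _
    _ ≤ _ := by gcongr; exact mul_le_of_le_one_right' prob_le_one

theorem isProbabilityMeasure_condensateLaw {μ : PMF ℕ} (h1 : μ 1 ≠ 0) (n m : ℕ) (a : PlaneTree) :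
    IsProbabilityMeasure (condensateLaw μ n (m + 1) a) := by
  have := isProbabilityMeasure_posLaw h1
  rw [condensateLaw_succ]
  exact isProbabilityMeasure_bind Measurable.of_discrete.aemeasurable
    (ae_of_all _ fun z => inferInstance)

theorem isProbabilityMeasure_condBGWLaw {μ : PMF ℕ} (hμ : ∀ j, μ j ≠ 0) {n m : ℕ}
    (hn : 2 * m + 2 ≤ n) : IsProbabilityMeasure (condBGWLaw μ n (m + 1)) := by
  refine cond_isProbabilityMeasure_of_finite ?_ ?_
  · set t := PlaneTree.condensate (Pi.single (0 : Fin (m + 1)) (n - (2 * m + 1)))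
      (fun _ : Fin m => 1) with ht
    have htm : t ∈ PlaneTree.treesWith n (m + 1) := by
      refine ⟨?_, PlaneTree.numInternal_condensate (fun _ => le_rfl) ?_⟩
      · rw [ht, PlaneTree.numVertices_condensate]
        simp
        omega
      · simp
        omega
    rw [bgwLaw_apply]
    refine fun h => ?_
    have := ENNReal.tsum_eq_zero.1 h t
    rw [Set.indicator_of_mem htm, ht, PlaneTree.weight_condensate] at this
    simp [hμ] at this
  · obtain ⟨s, rfl⟩ := Nat.exists_eq_add_of_le' (by omega : 1 ≤ n)
    exact ne_top_of_le_ne_top ENNReal.ofReal_ne_top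
      (bgwLaw_treesWith_le μ (p := fun j => if j = 0 then 0 else (μ j).toReal) (if_pos rfl)
        (fun j hj => if_neg (by omega)) s (m + 1))

/-! ### Convergence of the mass ratio -/

theorem tendsto_choose_sub_div_choose (m S : ℕ) :
    Tendsto (fun n : ℕ => ((n - S).choose m : ℝ) / n.choose m) atTop (𝓝 1) := by
  have hne : ∀ᶠ n : ℕ in atTop, (n : ℝ) ^ m / m.factorial ≠ 0 := by
    filter_upwards [eventually_ge_atTop 1] with n hn
    have : (n : ℝ) ≠ 0 := by exact_mod_cast (by omega : n ≠ 0)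
    positivity
  have h1 := (Asymptotics.isEquivalent_iff_tendsto_one hne).1 (isEquivalent_choose m)
  have h2 := h1.comp (tendsto_sub_atTop_nat S)
  have h3 : Tendsto (fun n : ℕ => (((n - S : ℕ) : ℝ) / n) ^ m) atTop (𝓝 1) := by
    have h4 : Tendsto (fun n : ℕ => 1 - (S : ℝ) / n) atTop (𝓝 1) := by
      simpa using (tendsto_const_div_atTop_nhds_zero_nat (S : ℝ)).const_sub 1
    rw [← one_pow m]
    refine (h4.congr' ?_).pow m
    filter_upwards [eventually_ge_atTop (S + 1)] with n hn
    have : (n : ℝ) ≠ 0 := by exact_mod_cast (by omega : n ≠ 0)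
    rw [Nat.cast_sub (by omega)]
    field_simp
  have h5 := (h2.mul h3).div h1 one_ne_zero
  rw [one_mul, div_one] at h5
  refine h5.congr' ?_
  filter_upwards [eventually_ge_atTop (S + 1 + m)] with n hn
  have e1 : (n : ℝ) ≠ 0 := by exact_mod_cast (by omega : n ≠ 0)
  have e2 : ((n - S : ℕ) : ℝ) ≠ 0 := by exact_mod_cast (by omega : n - S ≠ 0)
  have e3 : (n.choose m : ℝ) ≠ 0 := by exact_mod_cast (Nat.choose_pos (by omega)).ne'
  have e4 : (m.factorial : ℝ) ≠ 0 := by exact_mod_cast m.factorial_ne_zero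
  simp only [Pi.div_apply, Function.comp_apply, div_pow]
  field_simp

/-- The total mass that `μ` gives to the positive integers, in terms of a real-valued copy `p` of
its restriction. -/
theorem hasSum_of_toReal_eq {μ : PMF ℕ} {p : ℕ → ℝ} (hp0 : p 0 = 0)
    (hp : ∀ j, 1 ≤ j → p j = (μ j).toReal) : HasSum p (1 - μ 0).toReal := by
  have h : HasSum (fun j => (μ j).toReal) 1 := by
    have := (ENNReal.summable_toReal μ.tsum_coe_ne_top).hasSum
    rwa [← ENNReal.tsum_toReal_eq fun j => μ.apply_ne_top j, μ.tsum_coe,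
      ENNReal.toReal_one] at this
  have h2 := h.update 0 0
  have e : Function.update (fun j => (μ j).toReal) 0 0 = p := by
    funext j
    rcases Nat.eq_zero_or_pos j with rfl | hj
    · simp [hp0]
    · rw [Function.update_of_ne hj.ne', hp j hj]
  rw [e] at h2
  have e' : (1 - μ 0).toReal = 0 - (μ 0).toReal + 1 := by
    rw [ENNReal.toReal_sub_of_le (μ.coe_le_one 0) ENNReal.one_ne_top, ENNReal.toReal_one]
    ring
  rw [e']
  exact h2

/-- By the upper bound on the partition function and its asymptotics, the mass ratio is
asymptotically at least `1`. -/
theorem tendsto_one_sub_massRatio {μ : PMF ℕ} (hμ0 : μ 0 ≠ 0) {p : ℕ → ℝ} (hpl : LongTailed p)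
    (hp0 : p 0 = 0) (hp : ∀ j, 1 ≤ j → p j = (μ j).toReal) {m : ℕ} (z : Fin m → ℕ) :
    Tendsto (fun n => 1 - massRatio μ n z) atTop (𝓝 0) := by
  set S := ∑ i, z i with hS
  set q := (μ 0).toReal with hq
  set G := (1 - μ 0).toReal with hG
  have hsum := hasSum_of_toReal_eq hp0 hp
  have hqpos : 0 < q := ENNReal.toReal_pos hμ0 (μ.apply_ne_top 0)
  have hGpos : 0 < G := by
    rw [hG, ← hsum.tsum_eq]
    exact hsum.summable.tsum_pos hpl.nonneg 1 (hpl.pos 1 le_rfl)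
  have hcoeff := (hpl.tendsto_coeff_pow hsum.summable m).1
  rw [hsum.tsum_eq] at hcoeff
  have hlim : 0 < ((m : ℝ) + 1) * G ^ m := by positivity
  set b : ℕ → ℝ := fun n => PowerSeries.coeff n (PowerSeries.mk p ^ (m + 1)) with hb
  have hρ : Tendsto (fun n => (((m : ℝ) + 1) * G ^ m) / (b n / p n) *
      (((n - S).choose m : ℝ) / n.choose m) * (p (n - S) / p n)) atTop (𝓝 1) := by
    have h1 := ((tendsto_const_nhds (x := ((m : ℝ) + 1) * G ^ m)).div hcoeff hlim.ne').mul
      (tendsto_choose_sub_div_choose m S) |>.mul (hpl.tendsto_sub S)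
    rwa [div_self hlim.ne', one_mul, one_mul] at h1
  have hlow := ENNReal.tendsto_ofReal ((tendsto_const_nhds (x := (1 : ℝ))).sub hρ)
  rw [sub_self, ENNReal.ofReal_zero] at hlow
  -- A tree with `n + 1` vertices has offspring numbers of total `n`.
  rw [← tendsto_add_atTop_iff_nat 1]
  refine tendsto_of_tendsto_of_tendsto_of_le_of_le' tendsto_const_nhds hlow
    (Eventually.of_forall fun _ => zero_le) ?_
  filter_upwards [hcoeff.eventually (lt_mem_nhds hlim), eventually_ge_atTop (S + m + 1)]
    with n hn hnS
  have hpn := hpl.pos n (by omega)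
  have hbn : 0 < b n := by
    have := mul_pos hn hpn
    rwa [div_mul_cancel₀ _ hpn.ne'] at this
  have hch : (0 : ℝ) < n.choose m := by exact_mod_cast Nat.choose_pos (by omega)
  have hch' : (0 : ℝ) < (n + 1).choose (m + 1) := by exact_mod_cast Nat.choose_pos (by omega)
  rw [ENNReal.ofReal_sub _ (by have := hpl.nonneg (n - S); positivity), ENNReal.ofReal_one]
  refine tsub_le_tsub_left ?_ _
  rw [massRatio, if_pos (by omega)]
  have hW := bgwLaw_treesWith_le μ hp0 hp n (m + 1)
  rw [← hq] at hW
  have hw : 0 < ((n + 1).choose (m + 1) : ℝ) / (n + 1) * q ^ (n + 1 - (m + 1)) * b n := by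
    positivity
  refine le_trans ?_ (mul_le_mul_left (ENNReal.inv_le_inv.2 hW) _)
  have e0 : μ 0 = ENNReal.ofReal q := (ENNReal.ofReal_toReal (μ.apply_ne_top 0)).symm
  have e1 : 1 - μ 0 = ENNReal.ofReal G :=
    (ENNReal.ofReal_toReal (ENNReal.sub_ne_top ENNReal.one_ne_top)).symm
  have e2 : μ (n + 1 - 1 - S) = ENNReal.ofReal (p (n - S)) := by
    rw [hp _ (by omega), ENNReal.ofReal_toReal (μ.apply_ne_top _)]
    rfl
  rw [e1, ← hS, e2, e0, ← ENNReal.ofReal_natCast, ← ENNReal.ofReal_inv_of_pos hw,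
    ← ENNReal.ofReal_pow hqpos.le, ← ENNReal.ofReal_pow hGpos.le,
    ← ENNReal.ofReal_mul (by positivity), ← ENNReal.ofReal_mul (by positivity),
    ← ENNReal.ofReal_mul (mul_nonneg (by positivity) (hpl.nonneg _)),
    ← ENNReal.ofReal_mul (by positivity)]
  -- The power of `q` cancels and `(n + 1).choose (m + 1) / (n + 1) = n.choose m / (m + 1)`, which
  -- leaves the three factors of `hρ`.
  refine ENNReal.ofReal_le_ofReal (le_of_eq ?_)
  have hc : ((n + 1).choose (m + 1) : ℝ) = (n + 1) * n.choose m / (m + 1) := by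
    rw [eq_div_iff (by positivity)]
    exact_mod_cast (Nat.add_one_mul_choose_eq n m).symm
  rw [hc, show n + 1 - 1 - S = n - S by omega]
  field_simp

/-! ### Convergence in total variation -/

theorem mainTheorem2 (μ : PMF ℕ) (l : ℝ≥0 → ℝ) (β : ℝ) (hl : SlowlyVarying l) (hβ : 1 < β)
    (hμ0 : 0 < μ 0) (hμ : ∀ i : ℕ, 1 ≤ i → (μ i).toReal = l i / (i : ℝ) ^ (1 + β))
    (k : ℕ) (hk : 1 ≤ k) (a : ℕ → PlaneTree) :
    Tendsto (fun n : ℕ => tvDist (condBGWLaw μ n k) (condensateLaw μ n k (a n))) atTop (𝓝 0) := by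
  obtain ⟨m, rfl⟩ := Nat.exists_eq_add_of_le' hk
  set p : ℕ → ℝ := fun j => if j = 0 then 0 else (μ j).toReal with hpdef
  have hp0 : p 0 = 0 := if_pos rfl
  have hp : ∀ j, 1 ≤ j → p j = (μ j).toReal := fun j hj => if_neg (by omega)
  have hpl : LongTailed p := hl.longTailed (α := 1 + β) (by linarith) hp0.ge
    fun i hi => by rw [hp i hi, hμ i hi]
  have hpos : ∀ j, μ j ≠ 0 := by
    intro j hj
    rcases Nat.eq_zero_or_pos j with rfl | hj'
    · exact hμ0.ne' hj
    · have := hpl.pos j hj'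
      rw [hp j hj', hj, ENNReal.toReal_zero] at this
      exact this.false
  have := isProbabilityMeasure_posLaw (hpos 1)
  set ν := Measure.pi fun _ : Fin m => posLaw μ
  have hδ : Tendsto (fun n => ∫⁻ z, (1 - massRatio μ n z) ∂ν) atTop (𝓝 0) := by
    have h := tendsto_lintegral_of_dominated_convergence (μ := ν)
      (F := fun n z => 1 - massRatio μ n z) (f := fun _ => 0) (fun _ => 1)
      (fun n => Measurable.of_discrete) (fun n => ae_of_all _ fun z => tsub_le_self) (by simp)
      (ae_of_all _ fun z => tendsto_one_sub_massRatio hμ0.ne' hpl hp0 hp z)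
    simpa using h
  have hδtop : ∀ n, ∫⁻ z, (1 - massRatio μ n z) ∂ν ≠ ∞ := fun n =>
    ne_top_of_le_ne_top ENNReal.one_ne_top
      ((lintegral_mono fun z => tsub_le_self).trans (by simp))
  have hδreal := (ENNReal.tendsto_toReal ENNReal.zero_ne_top).comp hδ
  rw [ENNReal.toReal_zero] at hδreal
  refine tendsto_of_tendsto_of_tendsto_of_le_of_le' tendsto_const_nhds hδreal
    (Eventually.of_forall fun _ => tvDist_nonneg _ _) ?_
  filter_upwards [eventually_ge_atTop (2 * m + 2)] with n hn
  have := isProbabilityMeasure_condBGWLaw hpos hn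
  have := isProbabilityMeasure_condensateLaw (hpos 1) n m (a n)
  exact tvDist_le_of_forall_le_add (hδtop n) fun A _ =>
    condensateLaw_le (hpos 1) m (by omega) (a n) A
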